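/- Let $D\ge 0$ be an integer, $a,h>0$, let $k(z)=a\,e^{-\|z\|^2/(2h)}$ for $z\in\mathbb R^D$, and let $K(x,y)=k(x-y)$ be the corresponding Gaussian kernel on $\mathbb R^D$. Let $q$ be a probability measure on $\mathbb R^D$ that is absolutely continuous with respect to Lebesgue measure. Let $\mathcal H$ be the reproducing kernel Hilbert space of real-valued functions on $\mathbb R^D$ with kernel $K$, and let $\mathcal H^D$ be the vector-valued RKHS of $K$, that is, the $D$-fold Hilbert space product of $\mathcal H$ with inner product $\langle u,v\rangle_{\mathcal H^D}=\sum_{i=1}^D\langle u_i,v_i\rangle_{\mathcal H}$. Let $\mathcal L^2_q$ be the Hilbert space of ($q$-a.e. classes of) functions $u:\mathbb R^D\to\mathbb R^D$ with $\int\|u\|^2\,dq<\infty$ and inner product $\int u\cdot v\,dq$. Write $(\phi*K)(x)=\int_{\mathbb R^D}k(x-y)\,\phi(y)\,dy$, and let $\mathcal G$ be the closure in $\mathcal L^2_q$ of the set $\{\phi*K:\phi\in C_c^\infty(\mathbb R^D;\mathbb R^D)\}$, with the inner product of $\mathcal L^2_q$. Then $\mathcal H^D$ and $\mathcal G$ are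 isometrically isomorphic as Hilbert spaces: there is a linear isometric bijection $\mathcal H^D\to\mathcal G$. -/

import Mathlib

open MeasureTheory
open scoped NNReal ContDiff Convolution

noncomputable section

namespace GaussianSmoothing

/-- The Gaussian function `z ↦ a * exp (-‖z‖² / (2 h))` on `ℝ^D`, with amplitude `a` and
bandwidth (variance) `h`. -/
def gaussianFun (D : ℕ) (a h : ℝ≥0) (z : EuclideanSpace ℝ (Fin D)) : ℝ :=
  a * Real.exp (-‖z‖ ^ 2 / (2 * h))

/-- The Gaussian kernel `K(x, y) = a * exp (-‖x - y‖² / (2 h))` on `ℝ^D`. The real number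
`K(x, y)` is viewed as the operator "multiplication by `K(x, y)`" on `ℝ`, which is the form in
which Mathlib treats kernels. -/
def gaussianKernel (D : ℕ) (a h : ℝ≥0) :
    Matrix (EuclideanSpace ℝ (Fin D)) (EuclideanSpace ℝ (Fin D)) (ℝ →L[ℝ] ℝ) :=
  Matrix.of fun x y => gaussianFun D a h (x - y) • ContinuousLinearMap.id ℝ ℝ

lemma gaussianFun_neg (D : ℕ) (a h : ℝ≥0) (z : EuclideanSpace ℝ (Fin D)) :
    gaussianFun D a h (-z) = gaussianFun D a h z := by
  simp [gaussianFun]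

lemma continuous_gaussianFun (D : ℕ) (a h : ℝ≥0) : Continuous (gaussianFun D a h) := by
  unfold gaussianFun
  fun_prop

/-- The product of two half-width Gaussians, integrated over the common centre. -/
lemma exp_mul_exp (D : ℕ) (h : ℝ≥0) (x y z : EuclideanSpace ℝ (Fin D)) :
    Real.exp (-‖x - z‖ ^ 2 / h) * Real.exp (-‖y - z‖ ^ 2 / h)
      = Real.exp (-‖x - y‖ ^ 2 / (2 * h)) *
        Real.exp (-(2 / (h : ℝ)) * ‖z - (1 / 2 : ℝ) • (x + y)‖ ^ 2) := by
  rw [← Real.exp_add, ← Real.exp_add]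
  congr 1
  have h1 : ‖x - z‖ ^ 2 + ‖y - z‖ ^ 2
      = ‖x - y‖ ^ 2 / 2 + 2 * ‖z - (1 / 2 : ℝ) • (x + y)‖ ^ 2 := by
    have := parallelogram_law_with_norm ℝ (x - z) (y - z)
    have e1 : x - z + (y - z) = (-2 : ℝ) • (z - (1 / 2 : ℝ) • (x + y)) := by module
    have e2 : x - z - (y - z) = x - y := by abel
    rw [e1, e2, norm_smul, mul_pow] at this
    have e3 : ‖(-2 : ℝ)‖ ^ 2 = 4 := by norm_num
    rw [e3] at this
    linarith
  by_cases hh : (h : ℝ) = 0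
  · simp [hh]
  · field_simp
    linarith

lemma integrable_exp (D : ℕ) (h : ℝ≥0) (hh : 0 < h) (c : EuclideanSpace ℝ (Fin D)) :
    Integrable (fun z => Real.exp (-(2 / (h : ℝ)) * ‖z - c‖ ^ 2)) := by
  have hb : (0 : ℝ) < 2 / (h : ℝ) := by positivity
  have h0 := GaussianFourier.integrable_cexp_neg_mul_sq_norm_add
    (V := EuclideanSpace ℝ (Fin D)) (b := ((2 / (h : ℝ) : ℝ) : ℂ)) (by simpa using hb) 0 0
  have h1 : Integrable (fun z : EuclideanSpace ℝ (Fin D) =>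
      Real.exp (-(2 / (h : ℝ)) * ‖z‖ ^ 2)) := by
    refine h0.re.congr (Filter.Eventually.of_forall fun z => ?_)
    simp only [zero_mul, add_zero]
    rw [← Complex.ofReal_pow, ← Complex.ofReal_neg, ← Complex.ofReal_mul]
    exact Complex.exp_ofReal_re _
  exact h1.comp_sub_right c

lemma quadraticForm_nonneg (D : ℕ) (a h : ℝ≥0) (s : Finset (EuclideanSpace ℝ (Fin D)))
    (w : EuclideanSpace ℝ (Fin D) → ℝ) :
    0 ≤ ∑ x ∈ s, ∑ y ∈ s, w x * w y * gaussianFun D a h (x - y) := by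
  rcases eq_or_ne h 0 with rfl | hne
  · have : ∑ x ∈ s, ∑ y ∈ s, w x * w y * gaussianFun D a 0 (x - y)
        = a * (∑ x ∈ s, w x) ^ 2 := by
      rw [sq, Finset.sum_mul_sum, Finset.mul_sum]
      refine Finset.sum_congr rfl fun x _ => ?_
      rw [Finset.mul_sum]
      refine Finset.sum_congr rfl fun y _ => ?_
      simp [gaussianFun]
      ring
    rw [this]
    positivity
  have hh : 0 < h := pos_iff_ne_zero.mpr hne
  set C : ℝ := ∫ z : EuclideanSpace ℝ (Fin D), Real.exp (-(2 / (h : ℝ)) * ‖z‖ ^ 2) with hC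
  have hCpos : 0 < C := by
    have := integrable_exp D h hh 0
    simp only [sub_zero] at this
    exact integral_exp_pos this
  have key : ∀ x y : EuclideanSpace ℝ (Fin D),
      Integrable (fun z => Real.exp (-‖x - z‖ ^ 2 / h) * Real.exp (-‖y - z‖ ^ 2 / h)) := by
    intro x y
    simp_rw [exp_mul_exp]
    exact (integrable_exp D h hh _).const_mul _
  have key2 : ∀ x y : EuclideanSpace ℝ (Fin D),
      ∫ z, Real.exp (-‖x - z‖ ^ 2 / h) * Real.exp (-‖y - z‖ ^ 2 / h)
        = Real.exp (-‖x - y‖ ^ 2 / (2 * h)) * C := by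
    intro x y
    simp_rw [exp_mul_exp]
    rw [integral_const_mul, hC]
    congr 1
    exact integral_sub_right_eq_self
      (fun z : EuclideanSpace ℝ (Fin D) => Real.exp (-(2 / (h : ℝ)) * ‖z‖ ^ 2)) _
  have e : C * ∑ x ∈ s, ∑ y ∈ s, w x * w y * gaussianFun D a h (x - y)
      = a * ∫ z, (∑ x ∈ s, w x * Real.exp (-‖x - z‖ ^ 2 / h)) ^ 2 := by
    have e1 : ∀ z : EuclideanSpace ℝ (Fin D),
        (∑ x ∈ s, w x * Real.exp (-‖x - z‖ ^ 2 / h)) ^ 2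
          = ∑ x ∈ s, ∑ y ∈ s, (w x * w y) *
            (Real.exp (-‖x - z‖ ^ 2 / h) * Real.exp (-‖y - z‖ ^ 2 / h)) := by
      intro z
      rw [sq, Finset.sum_mul_sum]
      refine Finset.sum_congr rfl fun x _ => Finset.sum_congr rfl fun y _ => ?_
      ring
    simp_rw [e1]
    rw [integral_finsetSum _ fun x _ =>
      integrable_finsetSum _ fun y _ => (key x y).const_mul _, Finset.mul_sum, Finset.mul_sum]
    refine Finset.sum_congr rfl fun x _ => ?_
    rw [integral_finsetSum _ fun y _ => (key x y).const_mul _, Finset.mul_sum, Finset.mul_sum]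
    refine Finset.sum_congr rfl fun y _ => ?_
    rw [integral_const_mul, key2, gaussianFun]
    ring
  have hpos : 0 ≤ C * ∑ x ∈ s, ∑ y ∈ s, w x * w y * gaussianFun D a h (x - y) := by
    rw [e]
    exact mul_nonneg a.2 (integral_nonneg fun z => sq_nonneg _)
  exact nonneg_of_mul_nonneg_right hpos hCpos

/-- The Gaussian kernel is positive semidefinite, so that it has a reproducing kernel Hilbert
space. -/
instance fact_posSemidef_gaussianKernel (D : ℕ) (a h : ℝ≥0) :
    Fact (gaussianKernel D a h).PosSemidef := by
  have htfae := (RKHS.posSemidef_tfae (K := gaussianKernel D a h)).out 0 2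
  refine ⟨htfae.mpr ⟨?_, fun vv => ?_⟩⟩
  · ext x y
    simp only [gaussianKernel, Matrix.conjTranspose_apply, Matrix.of_apply]
    rw [← neg_sub, gaussianFun_neg]
    have hone : star (ContinuousLinearMap.id ℝ ℝ) = ContinuousLinearMap.id ℝ ℝ :=
      star_one (ℝ →L[ℝ] ℝ)
    rw [star_smul, hone, star_trivial]
  · have := quadraticForm_nonneg D a h vv.support vv
    simp only [Finsupp.sum, gaussianKernel, Matrix.of_apply, RCLike.re_to_real]
    refine this.trans_eq (Finset.sum_congr rfl fun x _ => Finset.sum_congr rfl fun y _ => ?_)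
    rw [← neg_sub, gaussianFun_neg]
    simp
    ring

/-- The scalar-valued reproducing kernel Hilbert space `H` of the Gaussian kernel on `ℝ^D`. -/
def GaussianRKHS (D : ℕ) (a h : ℝ≥0) : Type :=
  RKHS.OfKernel (gaussianKernel D a h)

instance (D : ℕ) (a h : ℝ≥0) : NormedAddCommGroup (GaussianRKHS D a h) :=
  inferInstanceAs (NormedAddCommGroup (RKHS.OfKernel (gaussianKernel D a h)))

instance (D : ℕ) (a h : ℝ≥0) : InnerProductSpace ℝ (GaussianRKHS D a h) :=
  inferInstanceAs (InnerProductSpace ℝ (RKHS.OfKernel (gaussianKernel D a h)))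

instance (D : ℕ) (a h : ℝ≥0) : CompleteSpace (GaussianRKHS D a h) :=
  inferInstanceAs (CompleteSpace (RKHS.OfKernel (gaussianKernel D a h)))

/-- Elements of `H` are functions `ℝ^D → ℝ`, and evaluation at each point is continuous. -/
instance (D : ℕ) (a h : ℝ≥0) :
    RKHS ℝ (GaussianRKHS D a h) (EuclideanSpace ℝ (Fin D)) ℝ :=
  inferInstanceAs (RKHS ℝ (RKHS.OfKernel (gaussianKernel D a h)) (EuclideanSpace ℝ (Fin D)) ℝ)

/-- The reproducing kernel of `H` is the Gaussian kernel. -/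
theorem kernel_gaussianRKHS (D : ℕ) (a h : ℝ≥0) :
    RKHS.kernel (GaussianRKHS D a h) = gaussianKernel D a h :=
  RKHS.OfKernel.kernel_ofKernel (K := gaussianKernel D a h)

/-- The vector-valued reproducing kernel Hilbert space `H^D`: the `D`-fold Hilbert space product
of `H`, with `⟪u, v⟫ = ∑ i, ⟪u i, v i⟫`; its element `u` is the vector field
`x ↦ (u 0 x, …, u (D-1) x)`. -/
abbrev VectorGaussianRKHS (D : ℕ) (a h : ℝ≥0) : Type :=
  PiLp 2 (fun _ : Fin D => GaussianRKHS D a h)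

/-- The convolution `(φ * K)(x) = ∫ K(x - y) φ(y) dy` of a vector field `φ` with the Gaussian,
with respect to Lebesgue measure. -/
def smooth (D : ℕ) (a h : ℝ≥0) (φ : EuclideanSpace ℝ (Fin D) → EuclideanSpace ℝ (Fin D)) :
    EuclideanSpace ℝ (Fin D) → EuclideanSpace ℝ (Fin D) :=
  φ ⋆[(ContinuousLinearMap.lsmul ℝ ℝ).flip, volume] gaussianFun D a h

lemma smooth_apply (D : ℕ) (a h : ℝ≥0)
    (φ : EuclideanSpace ℝ (Fin D) → EuclideanSpace ℝ (Fin D)) (x : EuclideanSpace ℝ (Fin D)) :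
    smooth D a h φ x = ∫ y, gaussianFun D a h (x - y) • φ y := rfl

lemma convolutionExists (D : ℕ) (a h : ℝ≥0)
    {φ : EuclideanSpace ℝ (Fin D) → EuclideanSpace ℝ (Fin D)}
    (hφ : Continuous φ) (hc : HasCompactSupport φ) :
    ConvolutionExists φ (gaussianFun D a h) (ContinuousLinearMap.lsmul ℝ ℝ).flip volume :=
  hc.convolutionExists_left _ hφ (continuous_gaussianFun D a h).locallyIntegrable

/-- For a finite measure `q`, every `φ * K` with `φ` continuous of compact support is in
`L²(q)`. -/
lemma memLp_smooth (D : ℕ) (a h : ℝ≥0) (q : Measure (EuclideanSpace ℝ (Fin D)))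
    [IsFiniteMeasure q] {φ : EuclideanSpace ℝ (Fin D) → EuclideanSpace ℝ (Fin D)}
    (hφ : Continuous φ) (hc : HasCompactSupport φ) : MemLp (smooth D a h φ) 2 q := by
  have hcont : Continuous (smooth D a h φ) :=
    hc.continuous_convolution_left _ hφ (continuous_gaussianFun D a h).locallyIntegrable
  refine MemLp.of_bound hcont.aestronglyMeasurable (∫ y, a * ‖φ y‖)
    (Filter.Eventually.of_forall fun x => ?_)
  rw [smooth_apply]
  refine norm_integral_le_of_norm_le ((hφ.integrable_of_hasCompactSupport hc).norm.const_mul _)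
    (Filter.Eventually.of_forall fun y => ?_)
  rw [norm_smul]
  refine mul_le_mul_of_nonneg_right ?_ (norm_nonneg _)
  rw [gaussianFun, Real.norm_eq_abs, abs_of_nonneg (by positivity)]
  refine mul_le_of_le_one_right a.2 (Real.exp_le_one_iff.mpr ?_)
  exact div_nonpos_of_nonpos_of_nonneg (by simp) (by positivity)

/-- The linear subspace `{φ * K : φ ∈ C_c^∞(ℝ^D; ℝ^D)}` of `L²(q; ℝ^D)`. -/
def smoothedSubspace (D : ℕ) (a h : ℝ≥0) (q : Measure (EuclideanSpace ℝ (Fin D))) :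
    Submodule ℝ (Lp (EuclideanSpace ℝ (Fin D)) 2 q) where
  carrier := {u | ∃ φ : EuclideanSpace ℝ (Fin D) → EuclideanSpace ℝ (Fin D),
    ContDiff ℝ ∞ φ ∧ HasCompactSupport φ ∧ u =ᵐ[q] smooth D a h φ}
  zero_mem' := by
    refine ⟨0, contDiff_const, HasCompactSupport.zero, ?_⟩
    have : smooth D a h 0 = 0 := by
      funext x
      simp [smooth_apply]
    rw [this]
    exact Lp.coeFn_zero _ _ _
  add_mem' := by
    rintro u v ⟨φ, hφ, hφc, hu⟩ ⟨ψ, hψ, hψc, hv⟩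
    refine ⟨φ + ψ, hφ.add hψ, hφc.add hψc, ?_⟩
    have : smooth D a h (φ + ψ) = smooth D a h φ + smooth D a h ψ :=
      (convolutionExists D a h hφ.continuous hφc).add_distrib
        (convolutionExists D a h hψ.continuous hψc)
    rw [this]
    exact (Lp.coeFn_add u v).trans (hu.add hv)
  smul_mem' := by
    rintro c u ⟨φ, hφ, hφc, hu⟩
    refine ⟨c • φ, contDiff_const.smul hφ, hφc.smul_left (f := fun _ => c), ?_⟩
    have : smooth D a h (c • φ) = c • smooth D a h φ := smul_convolution
    rw [this]
    exact (Lp.coeFn_smul c u).trans (hu.const_smul c)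

/-- The closure of `{φ * K : φ ∈ C_c^∞(ℝ^D; ℝ^D)}` in `L²(q; ℝ^D)`, a Hilbert space with the
inner product `∫ u · v dq` of `L²(q; ℝ^D)`. -/
def smoothedClosure (D : ℕ) (a h : ℝ≥0) (q : Measure (EuclideanSpace ℝ (Fin D))) :
    Submodule ℝ (Lp (EuclideanSpace ℝ (Fin D)) 2 q) :=
  (smoothedSubspace D a h q).topologicalClosure

end GaussianSmoothing

end

/-! For `D ≥ 1` both sides are infinite-dimensional separable Hilbert spaces, and any two of these
are isometric through countable Hilbert bases; for `D = 0` both vanish. The isometry is thus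
abstract and is not given by smoothing. Separability: a continuous kernel makes the span of the
kernel functions separable, and the closure sits inside the separable space `L²(q)`. Infinite
dimension: dividing a relation among the translates `k(z - n eᵢ)` by `k(z)` leaves a polynomial in
`exp (zᵢ / h)`. If nonzero, it vanishes only on finitely many hyperplanes, which are Lebesgue-null
and hence `q`-null (`eq_zero_of_ae_sum_gaussianFun_eq_zero`). The translates lie in the RKHS as
kernel functions, and in the closure as uniform limits of smoothed bumps
(`toLp_gaussianFun_smul_mem_smoothedClosure`). -/

noncomputable section

/-! ### Separable Hilbert spaces and separability of an RKHS. -/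

section HilbertSpace

variable {𝕜 E F : Type*} [RCLike 𝕜]
  [NormedAddCommGroup E] [InnerProductSpace 𝕜 E] [NormedAddCommGroup F] [InnerProductSpace 𝕜 F]

/-- The vectors of an orthonormal family are at distance at least `1` from each other. -/
theorem Orthonormal.one_le_dist {ι : Type*} {v : ι → E} (hv : Orthonormal 𝕜 v) {i j : ι}
    (hij : i ≠ j) : 1 ≤ dist (v i) (v j) := by
  have h := norm_sub_sq (𝕜 := 𝕜) (v i) (v j)
  rw [hv.1 i, hv.1 j, hv.2 hij] at h
  rw [dist_eq_norm]
  simp only [map_zero] at h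
  nlinarith [norm_nonneg (v i - v j)]

/-- In a separable inner product space every orthonormal family is countable. -/
theorem Orthonormal.countable_index [TopologicalSpace.SeparableSpace E] {ι : Type*} {v : ι → E}
    (hv : Orthonormal 𝕜 v) : Countable ι := by
  -- Balls of radius `1/2` about the vectors are disjoint, and a separable space has only countably
  -- many disjoint nonempty open sets.
  refine Pairwise.countable_of_isOpen_disjoint (s := fun i => Metric.ball (v i) (1 / 2))
    (fun i j hij => ?_) (fun _ => Metric.isOpen_ball)
    (fun _ => Metric.nonempty_ball.mpr (by norm_num))
  exact Metric.ball_disjoint_ball (by linarith [hv.one_le_dist hij])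

/-- An infinite-dimensional separable Hilbert space has a Hilbert basis indexed by `ℕ`. -/
theorem nonempty_hilbertBasis_nat [CompleteSpace E] [TopologicalSpace.SeparableSpace E]
    (hE : ¬ FiniteDimensional 𝕜 E) : Nonempty (HilbertBasis ℕ 𝕜 E) := by
  obtain ⟨w, b, -⟩ := exists_hilbertBasis 𝕜 E
  have := b.orthonormal.countable_index
  have : Infinite w := by
    by_contra hw
    rw [not_infinite_iff_finite] at hw
    have := Fintype.ofFinite w
    exact hE b.toOrthonormalBasis.toBasis.finiteDimensional_of_finite
  obtain ⟨e⟩ := nonempty_equiv_of_countable (α := ℕ) (β := w)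
  refine ⟨HilbertBasis.mk (b.orthonormal.comp e e.injective) ?_⟩
  rw [e.surjective.range_comp]
  exact b.dense_span.ge

/-- Any two infinite-dimensional separable Hilbert spaces are isometrically isomorphic. -/
theorem nonempty_linearIsometryEquiv_of_separable [CompleteSpace E]
    [TopologicalSpace.SeparableSpace E] [CompleteSpace F] [TopologicalSpace.SeparableSpace F]
    (hE : ¬ FiniteDimensional 𝕜 E) (hF : ¬ FiniteDimensional 𝕜 F) : Nonempty (E ≃ₗᵢ[𝕜] F) := by
  obtain ⟨b⟩ := nonempty_hilbertBasis_nat hE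
  obtain ⟨c⟩ := nonempty_hilbertBasis_nat hF
  exact ⟨b.repr.trans c.repr.symm⟩

/-- A reproducing kernel Hilbert space on a separable topological space is separable, provided
its kernel functions depend continuously on the point. -/
theorem RKHS.separableSpace_of_continuous_kerFun {H X V : Type*} [NormedAddCommGroup V]
    [InnerProductSpace 𝕜 V] [CompleteSpace V] [NormedAddCommGroup H] [InnerProductSpace 𝕜 H]
    [CompleteSpace H] [RKHS 𝕜 H X V] [TopologicalSpace X] [TopologicalSpace.SeparableSpace X]
    [TopologicalSpace.SeparableSpace V]
    (hc : Continuous fun p : X × V => RKHS.kerFun H p.1 p.2) :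
    TopologicalSpace.SeparableSpace H := by
  have hs := (TopologicalSpace.isSeparable_range hc).span (R := 𝕜)
  have hd := RKHS.kerFun_dense (𝕜 := 𝕜) H
  have hr : (Set.range fun p : X × V => RKHS.kerFun H p.1 p.2)
      = {RKHS.kerFun H x v | (x : X) (v : V)} := by
    ext f
    simp
  rw [hr] at hs
  rw [← TopologicalSpace.isSeparable_univ_iff]
  refine hs.closure.mono ?_
  rw [← Submodule.topologicalClosure_coe, hd]
  exact le_rfl

end HilbertSpace

/-! ### Null hyperplanes and independence of Gaussian translates. -/

namespace EuclideanSpace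

/-- Coordinate hyperplanes of `ℝ^ι` are Lebesgue-null. -/
theorem volume_coordinate_hyperplane {ι : Type*} [Fintype ι] (i : ι) (s : ℝ) :
    volume {z : EuclideanSpace ℝ ι | z i = s} = 0 := by
  have hp : volume {f : ι → ℝ | f i = s} = 0 := by
    rw [volume_pi]
    exact Measure.pi_hyperplane (α := fun _ => ℝ) (fun _ => volume) i s
  have := (PiLp.volume_preserving_ofLp ι).measure_preimage
    (s := {f : ι → ℝ | f i = s}) (NullMeasurableSet.of_null hp)
  rw [hp] at this
  exact this

end EuclideanSpace

namespace GaussianSmoothing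

/-- The Gaussian centred at `n • eᵢ` is a multiple of the centred one times the `n`-th power of
`exp (zᵢ / h)`. -/
theorem gaussianFun_sub_single (D : ℕ) (a h : ℝ≥0) (i : Fin D) (n : ℕ)
    (z : EuclideanSpace ℝ (Fin D)) :
    gaussianFun D a h (z - EuclideanSpace.single i (n : ℝ))
      = gaussianFun D a h z * (Real.exp (-(n : ℝ) ^ 2 / (2 * h)) * Real.exp (z i / h) ^ n) := by
  have e : ‖z - EuclideanSpace.single i (n : ℝ)‖ ^ 2 = ‖z‖ ^ 2 - 2 * (n * z i) + (n : ℝ) ^ 2 := by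
    rw [norm_sub_sq_real, EuclideanSpace.inner_single_right, PiLp.norm_single]
    simp
  rw [gaussianFun, gaussianFun, e, ← Real.exp_nat_mul, mul_assoc, ← Real.exp_add, ← Real.exp_add]
  congr 2
  -- At `h = 0` every quotient is zero by convention, so both exponents vanish.
  by_cases hh : (h : ℝ) = 0
  · simp [hh]
  · field_simp
    ring

/-- The Gaussians centred at the points `n • eᵢ` are linearly independent modulo equality almost
everywhere with respect to a nonzero absolutely continuous measure. -/
theorem eq_zero_of_ae_sum_gaussianFun_eq_zero {D : ℕ} {a h : ℝ≥0} (ha : 0 < a) (hh : 0 < h)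
    (i : Fin D) {μ : Measure (EuclideanSpace ℝ (Fin D))} (hμ : μ ≪ volume) (hμ0 : μ ≠ 0)
    (s : Finset ℕ) (c : ℕ → ℝ)
    (hc : ∀ᵐ z ∂μ, ∑ n ∈ s, c n * gaussianFun D a h (z - EuclideanSpace.single i (n : ℝ)) = 0) :
    ∀ n ∈ s, c n = 0 := by
  classical
  set p : Polynomial ℝ :=
    ∑ n ∈ s, Polynomial.monomial n (c n * Real.exp (-(n : ℝ) ^ 2 / (2 * h))) with hp
  have hp0 : p = 0 := by
    by_contra hne
    -- Only positive roots can equal `exp (zᵢ / h)`; since `Real.log` is total, the others merely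
    -- add superfluous null hyperplanes.
    have hnull : volume (⋃ r ∈ p.roots.toFinset,
        {z : EuclideanSpace ℝ (Fin D) | z i = h * Real.log r}) = 0 :=
      (measure_biUnion_null_iff p.roots.toFinset.countable_toSet).mpr fun r _ =>
        EuclideanSpace.volume_coordinate_hyperplane i _
    have hfalse : ∀ᵐ z ∂μ, False := by
      filter_upwards [hc, measure_eq_zero_iff_ae_notMem.mp (hμ hnull)] with z hz hz'
      refine hz' ?_
      have hev : gaussianFun D a h z * p.eval (Real.exp (z i / h)) = 0 := by
        rw [← hz, hp, Polynomial.eval_finsetSum, Finset.mul_sum]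
        refine Finset.sum_congr rfl fun n _ => ?_
        rw [gaussianFun_sub_single, Polynomial.eval_monomial]
        ring
      have hg : gaussianFun D a h z ≠ 0 := by
        rw [gaussianFun]
        positivity
      have hroot := (mul_eq_zero.mp hev).resolve_left hg
      refine Set.mem_biUnion (x := Real.exp (z i / h)) ?_ ?_
      · simpa [hne] using hroot
      · have : (h : ℝ) ≠ 0 := by positivity
        simp only [Set.mem_ofPred_eq, Real.log_exp]
        field_simp
    rw [Filter.eventually_false_iff_eq_bot, ae_eq_bot] at hfalse
    exact hμ0 hfalse
  intro n hn
  have hcoeff : p.coeff n = c n * Real.exp (-(n : ℝ) ^ 2 / (2 * h)) := by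
    rw [hp, Polynomial.finsetSum_coeff]
    simp [Polynomial.coeff_monomial, hn]
  rw [hp0, Polynomial.coeff_zero] at hcoeff
  exact (mul_eq_zero.mp hcoeff.symm).resolve_right (Real.exp_ne_zero _)

/-- The Gaussian is uniformly continuous. -/
theorem uniformContinuous_gaussianFun (D : ℕ) (a : ℝ≥0) {h : ℝ≥0} (hh : 0 < h) :
    UniformContinuous (gaussianFun D a h) := by
  refine (continuous_gaussianFun D a h).uniformContinuous_of_tendsto_cocompact (x := a * 0) ?_
  refine Filter.Tendsto.const_mul _ (Real.tendsto_exp_atBot.comp ?_)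
  have h2 : (0 : ℝ) < 2 * h := by positivity
  refine Filter.Tendsto.atBot_div_const h2 ?_
  exact Filter.tendsto_neg_atTop_atBot.comp
    ((Filter.tendsto_pow_atTop two_ne_zero).comp tendsto_norm_cocompact_atTop)

/-! ### The RKHS is separable and infinite-dimensional. -/

theorem kerFun_gaussianRKHS_apply (D : ℕ) (a h : ℝ≥0) (x z : EuclideanSpace ℝ (Fin D)) (v : ℝ) :
    RKHS.kerFun (GaussianRKHS D a h) x v z = gaussianFun D a h (z - x) * v := by
  rw [RKHS.kerFun_apply, kernel_gaussianRKHS]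
  simp [gaussianKernel]

theorem inner_kerFun_gaussianRKHS (D : ℕ) (a h : ℝ≥0) (x y : EuclideanSpace ℝ (Fin D))
    (v w : ℝ) :
    inner ℝ (RKHS.kerFun (GaussianRKHS D a h) x v) (RKHS.kerFun (GaussianRKHS D a h) y w)
      = gaussianFun D a h (x - y) * v * w := by
  rw [RKHS.kerFun_inner, kerFun_gaussianRKHS_apply]
  simp
  ring

/-- By the reproducing property, the distance between two kernel functions is the square root of an
expression in values of the Gaussian, continuous in the points and zero when they coincide. -/
theorem continuous_kerFun_gaussianRKHS (D : ℕ) (a h : ℝ≥0) :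
    Continuous fun p : EuclideanSpace ℝ (Fin D) × ℝ =>
      RKHS.kerFun (GaussianRKHS D a h) p.1 p.2 := by
  rw [continuous_iff_continuousAt]
  intro p
  rw [ContinuousAt, tendsto_iff_norm_sub_tendsto_zero]
  have hn : ∀ r : EuclideanSpace ℝ (Fin D) × ℝ,
      ‖RKHS.kerFun (GaussianRKHS D a h) r.1 r.2 - RKHS.kerFun (GaussianRKHS D a h) p.1 p.2‖
        = √(gaussianFun D a h 0 * r.2 * r.2 - 2 * (gaussianFun D a h (r.1 - p.1) * r.2 * p.2)
          + gaussianFun D a h 0 * p.2 * p.2) := by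
    intro r
    rw [← Real.sqrt_sq (norm_nonneg (_ - _)), norm_sub_sq_real, ← real_inner_self_eq_norm_sq,
      ← real_inner_self_eq_norm_sq]
    simp only [inner_kerFun_gaussianRKHS, sub_self]
  simp_rw [hn]
  have hg := continuous_gaussianFun D a h
  have hcont : Continuous fun r : EuclideanSpace ℝ (Fin D) × ℝ =>
      √(gaussianFun D a h 0 * r.2 * r.2 - 2 * (gaussianFun D a h (r.1 - p.1) * r.2 * p.2)
          + gaussianFun D a h 0 * p.2 * p.2) := by
    fun_prop
  convert! hcont.tendsto p using 2
  rw [sub_self, eq_comm, Real.sqrt_eq_zero']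
  linarith

instance separableSpace_gaussianRKHS (D : ℕ) (a h : ℝ≥0) :
    TopologicalSpace.SeparableSpace (GaussianRKHS D a h) :=
  RKHS.separableSpace_of_continuous_kerFun (continuous_kerFun_gaussianRKHS D a h)

/-- The kernel functions at the points `n • eᵢ` are linearly independent. -/
theorem linearIndependent_kerFun {D : ℕ} {a h : ℝ≥0} (ha : 0 < a) (hh : 0 < h) (i : Fin D) :
    LinearIndependent ℝ fun n : ℕ =>
      RKHS.kerFun (GaussianRKHS D a h) (EuclideanSpace.single i (n : ℝ)) (1 : ℝ) := by
  rw [linearIndependent_iff']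
  intro s c hc
  refine eq_zero_of_ae_sum_gaussianFun_eq_zero ha hh i Measure.AbsolutelyContinuous.rfl
    (NeZero.ne volume) s c (Filter.Eventually.of_forall fun z => ?_)
  have := congrArg (fun f => RKHS.coeCLM ℝ f z) hc
  simpa [kerFun_gaussianRKHS_apply] using this

/-- The `i`-th projection is onto, so a finite-dimensional product would have a finite-dimensional
factor, contradicting the independent kernel functions. -/
theorem not_finiteDimensional_vectorGaussianRKHS {D : ℕ} {a h : ℝ≥0} (ha : 0 < a) (hh : 0 < h)
    (i : Fin D) : ¬ FiniteDimensional ℝ (VectorGaussianRKHS D a h) := by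
  intro hfin
  have : FiniteDimensional ℝ (GaussianRKHS D a h) :=
    Module.Finite.of_surjective
      (PiLp.proj 2 (𝕜 := ℝ) (fun _ : Fin D => GaussianRKHS D a h) i).toLinearMap
      fun f => ⟨WithLp.toLp 2 fun _ => f, rfl⟩
  have := (linearIndependent_kerFun ha hh i).finite
  exact not_finite ℕ

/-! ### The closure in `L²(q)` is separable and infinite-dimensional. -/

/-- The Gaussian vector field `z ↦ k (z - x) v` is in `L²(q)` for every finite measure `q`. -/
theorem memLp_gaussianFun_smul (D : ℕ) (a h : ℝ≥0) (q : Measure (EuclideanSpace ℝ (Fin D)))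
    [IsFiniteMeasure q] (x v : EuclideanSpace ℝ (Fin D)) :
    MemLp (fun z => gaussianFun D a h (z - x) • v) 2 q := by
  have hg := continuous_gaussianFun D a h
  have hcont : Continuous fun z => gaussianFun D a h (z - x) • v := by fun_prop
  refine MemLp.of_bound hcont.aestronglyMeasurable (a * ‖v‖) (Filter.Eventually.of_forall fun z => ?_)
  rw [norm_smul]
  refine mul_le_mul_of_nonneg_right ?_ (norm_nonneg _)
  rw [gaussianFun, Real.norm_eq_abs, abs_of_nonneg (by positivity)]
  refine mul_le_of_le_one_right a.2 (Real.exp_le_one_iff.mpr ?_)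
  exact div_nonpos_of_nonpos_of_nonneg (by simp) (by positivity)

/-- Smoothing a normalised bump around `x` with values on the line through `v` uniformly
approximates the Gaussian vector field `z ↦ k (z - x) v`. -/
theorem norm_smooth_bump_sub_le {D : ℕ} {a h : ℝ≥0} {x v : EuclideanSpace ℝ (Fin D)}
    (b : ContDiffBump x) {ε : ℝ} (z : EuclideanSpace ℝ (Fin D))
    (hb : ∀ y ∈ Metric.ball x b.rOut,
      ‖gaussianFun D a h (z - y) - gaussianFun D a h (z - x)‖ ≤ ε) :
    ‖smooth D a h (fun y => b.normed volume y • v) z - gaussianFun D a h (z - x) • v‖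
      ≤ ε * ‖v‖ := by
  have hg := continuous_gaussianFun D a h
  have hbc : Continuous (b.normed volume) := b.continuous_normed
  have hbi : Integrable (b.normed volume) := b.integrable_normed
  have hconv : Integrable fun y => gaussianFun D a h (z - y) • b.normed volume y • v :=
    Continuous.integrable_of_hasCompactSupport (by fun_prop)
      ((b.hasCompactSupport_normed.smul_right (f' := fun _ => v)).smul_left
        (f := fun y => gaussianFun D a h (z - y)))
  -- Since the bump has integral one, the target is itself an average against it, and the difference
  -- becomes one integral over the support of the bump.
  have hconst : gaussianFun D a h (z - x) • v
      = ∫ y, gaussianFun D a h (z - x) • b.normed volume y • v := by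
    rw [integral_smul, integral_smul_const, b.integral_normed, one_smul]
  have hconst' : Integrable fun y => gaussianFun D a h (z - x) • b.normed volume y • v :=
    (hbi.smul_const v).smul (gaussianFun D a h (z - x))
  rw [smooth_apply, hconst, ← integral_sub hconv hconst']
  have hbound : ∫ y, ε * ‖v‖ * b.normed volume y = ε * ‖v‖ := by
    rw [integral_const_mul, b.integral_normed, mul_one]
  rw [← hbound]
  refine norm_integral_le_of_norm_le (hbi.const_mul _) (Filter.Eventually.of_forall fun y => ?_)
  rw [← sub_smul, norm_smul, norm_smul, Real.norm_of_nonneg (b.nonneg_normed y)]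
  by_cases hy : y ∈ Metric.ball x b.rOut
  · calc _ ≤ ε * (b.normed volume y * ‖v‖) :=
          mul_le_mul_of_nonneg_right (hb y hy) (mul_nonneg (b.nonneg_normed y) (norm_nonneg v))
      _ = ε * ‖v‖ * b.normed volume y := by ring
  · have : b.normed volume y = 0 := by
      rwa [← b.support_normed_eq (μ := volume), Function.notMem_support] at hy
    simp [this]

/-- Gaussian vector fields `z ↦ k (z - x) v` lie in the closure of the smoothed fields. -/
theorem toLp_gaussianFun_smul_mem_smoothedClosure {D : ℕ} {a h : ℝ≥0} (hh : 0 < h)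
    (q : Measure (EuclideanSpace ℝ (Fin D))) [IsProbabilityMeasure q]
    (x v : EuclideanSpace ℝ (Fin D)) :
    (memLp_gaussianFun_smul D a h q x v).toLp ∈ smoothedClosure D a h q := by
  rw [smoothedClosure, ← SetLike.mem_coe, Submodule.topologicalClosure_coe, Metric.mem_closure_iff]
  intro ε hε
  -- The `+ 1` allows `v = 0`; this choice gives `η * ‖v‖ ≤ ε / 2`.
  set η : ℝ := ε / (2 * (‖v‖ + 1)) with hη
  have hη0 : 0 < η := by positivity
  obtain ⟨δ, hδ, hδ'⟩ := Metric.uniformContinuous_iff.mp (uniformContinuous_gaussianFun D a hh) η hη0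
  let b : ContDiffBump x := ⟨δ / 2, δ, by positivity, by linarith⟩
  have hsm : ContDiff ℝ ∞ fun y => b.normed volume y • v := b.contDiff_normed.smul contDiff_const
  have hcs : HasCompactSupport fun y => b.normed volume y • v :=
    b.hasCompactSupport_normed.smul_right (f' := fun _ => v)
  have hmem := memLp_smooth D a h q hsm.continuous hcs
  refine ⟨hmem.toLp, ⟨_, hsm, hcs, hmem.coeFn_toLp⟩, ?_⟩
  have hclose : ∀ z, ‖smooth D a h (fun y => b.normed volume y • v) z
      - gaussianFun D a h (z - x) • v‖ ≤ η * ‖v‖ := fun z =>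
    norm_smooth_bump_sub_le b z fun y hy => by
      rw [← dist_eq_norm]
      refine (hδ' ?_).le
      rw [dist_sub_left]
      exact hy
  rw [dist_comm, dist_eq_norm, ← MemLp.toLp_sub]
  have hle := Lp.norm_le_of_ae_bound (μ := q) (p := 2)
    (f := (hmem.sub (memLp_gaussianFun_smul D a h q x v)).toLp) (C := η * ‖v‖) (by positivity) (by
      filter_upwards [(hmem.sub (memLp_gaussianFun_smul D a h q x v)).coeFn_toLp] with z hz
      rw [hz]
      exact hclose z)
  refine hle.trans_lt ?_
  -- As `q` has total mass one, the uniform bound passes to the `L²` norm with no extra factor.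
  simp [measureUnivNNReal]
  have : η * (‖v‖ + 1) = ε / 2 := by
    rw [hη]
    field_simp
  nlinarith

/-- The Gaussian vector fields `z ↦ k (z - n • eᵢ) eᵢ` are linearly independent in the closure of
the smoothed fields, when `q` is absolutely continuous. -/
theorem linearIndependent_toLp_gaussianFun_smul {D : ℕ} {a h : ℝ≥0} (ha : 0 < a) (hh : 0 < h)
    (i : Fin D) (q : Measure (EuclideanSpace ℝ (Fin D))) [IsProbabilityMeasure q]
    (hq : q ≪ volume) :
    LinearIndependent ℝ fun n : ℕ => (⟨_, toLp_gaussianFun_smul_mem_smoothedClosure (a := a) hh q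
      (EuclideanSpace.single i (n : ℝ)) (EuclideanSpace.single i 1)⟩ :
        smoothedClosure D a h q) := by
  rw [linearIndependent_iff']
  intro s c hc
  refine eq_zero_of_ae_sum_gaussianFun_eq_zero ha hh i hq (IsProbabilityMeasure.ne_zero q) s c ?_
  have hc' := congrArg (Submodule.subtype _) hc
  simp only [map_sum, map_smul, map_zero, Submodule.subtype_apply] at hc'
  have hsum : (⇑(∑ n ∈ s, c n • (memLp_gaussianFun_smul D a h q
      (EuclideanSpace.single i (n : ℝ)) (EuclideanSpace.single i 1)).toLp) : _ → _) =ᵐ[q]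
      fun z => ∑ n ∈ s, c n • gaussianFun D a h (z - EuclideanSpace.single i (n : ℝ)) •
        EuclideanSpace.single i (1 : ℝ) := by
    refine (Lp.coeFn_finsetSum _ _).trans ?_
    have : ∀ n ∈ s, ∀ᵐ z ∂q, (c n • (memLp_gaussianFun_smul D a h q
        (EuclideanSpace.single i (n : ℝ)) (EuclideanSpace.single i 1)).toLp :
          Lp (EuclideanSpace ℝ (Fin D)) 2 q) z
        = c n • gaussianFun D a h (z - EuclideanSpace.single i (n : ℝ)) •
          EuclideanSpace.single i (1 : ℝ) := fun n _ => by
      filter_upwards [Lp.coeFn_smul (c n) (memLp_gaussianFun_smul D a h q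
        (EuclideanSpace.single i (n : ℝ)) (EuclideanSpace.single i 1)).toLp,
        (memLp_gaussianFun_smul D a h q (EuclideanSpace.single i (n : ℝ))
          (EuclideanSpace.single i 1)).coeFn_toLp] with z h1 h2
      rw [h1, Pi.smul_apply, h2]
    filter_upwards [(Finset.eventually_all s).mpr this] with z hz
    rw [Finset.sum_apply]
    exact Finset.sum_congr rfl hz
  rw [hc'] at hsum
  filter_upwards [hsum, Lp.coeFn_zero (EuclideanSpace ℝ (Fin D)) 2 q] with z h1 h2
  rw [h2] at h1
  -- The `i`-th coordinate of `eᵢ` is `1`, which recovers the scalar relation.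
  have := congrArg (fun w : EuclideanSpace ℝ (Fin D) => w i) h1
  simpa using this.symm

theorem not_finiteDimensional_smoothedClosure {D : ℕ} {a h : ℝ≥0} (ha : 0 < a) (hh : 0 < h)
    (i : Fin D) (q : Measure (EuclideanSpace ℝ (Fin D))) [IsProbabilityMeasure q]
    (hq : q ≪ volume) : ¬ FiniteDimensional ℝ (smoothedClosure D a h q) := by
  intro hfin
  have := (linearIndependent_toLp_gaussianFun_smul ha hh i q hq).finite
  exact not_finite ℕ

instance completeSpace_smoothedClosure (D : ℕ) (a h : ℝ≥0)
    (q : Measure (EuclideanSpace ℝ (Fin D))) : CompleteSpace (smoothedClosure D a h q) :=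
  (Submodule.isClosed_topologicalClosure _).completeSpace_coe

instance separableSpace_smoothedClosure (D : ℕ) (a h : ℝ≥0)
    (q : Measure (EuclideanSpace ℝ (Fin D))) [IsFiniteMeasure q] :
    TopologicalSpace.SeparableSpace (smoothedClosure D a h q) := by
  -- Separability of `Lp` needs a finite exponent, supplied here to instance search.
  have : Fact ((2 : ENNReal) ≠ ⊤) := ⟨ENNReal.ofNat_ne_top⟩
  infer_instance

instance separableSpace_vectorGaussianRKHS (D : ℕ) (a h : ℝ≥0) :
    TopologicalSpace.SeparableSpace (VectorGaussianRKHS D a h) := by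
  have := UniformSpace.secondCountable_of_separable (GaussianRKHS D a h)
  infer_instance

end GaussianSmoothing

end

theorem theorem2 (D : ℕ) (a h : ℝ≥0) (ha : 0 < a) (hh : 0 < h)
    (q : Measure (EuclideanSpace ℝ (Fin D))) [IsProbabilityMeasure q] (hq : q ≪ volume) :
    Nonempty (GaussianSmoothing.VectorGaussianRKHS D a h ≃ₗᵢ[ℝ]
      GaussianSmoothing.smoothedClosure D a h q) := by
  -- With no coordinates both spaces are zero; otherwise any index `i` provides the direction of the
  -- translates.
  rcases isEmpty_or_nonempty (Fin D) with hD | ⟨⟨i⟩⟩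
  · have h1 : Subsingleton (GaussianSmoothing.VectorGaussianRKHS D a h) :=
      ⟨fun u v => PiLp.ext fun i => isEmptyElim i⟩
    have h2 : Subsingleton (GaussianSmoothing.smoothedClosure D a h q) :=
      ⟨fun u v => Subtype.ext (Lp.ext (Filter.Eventually.of_forall fun z =>
        PiLp.ext fun i => isEmptyElim i))⟩
    exact ⟨⟨0, fun u => by simp [Subsingleton.elim u 0]⟩⟩
  · exact nonempty_linearIsometryEquiv_of_separable
      (GaussianSmoothing.not_finiteDimensional_vectorGaussianRKHS ha hh i)
      (GaussianSmoothing.not_finiteDimensional_smoothedClosure ha hh i q hq)
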